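/- Let $(X_p)_{p\ \mathrm{prime}}$ be independent random variables, each uniformly distributed on the unit circle $\{|z|=1\}$, let $X_{-1}$ be a random variable equal to $+1$ or $-1$ with probability $1/2$ each, and let $\eta$ be uniformly distributed on the unit circle, all on one probability space (no independence is required between $\eta$, $X_{-1}$ and the family $(X_p)_p$). Extend $X$ to a Steinhaus random multiplicative function on the nonzero integers by $X_n=\prod_{p^a\| n}X_p^a$ and $X_{-n}=X_{-1}X_n$ for $n\ge 1$. Write $e(x)=e^{2\pi i x}$, and let $P^+(n)$ be the largest prime factor of $n \geq 1$, with $P^+(1)=1$. For real $y$ and $t$ put $$S_y(t)=\frac{\eta}{\pi}\sum_{\substack{n\neq 0\\ P^+(|n|)\le y}}\frac{1-e(nt)}{n}X_n ,\qquad F(t)=\lim_{y\to\infty}S_y(t).$$ Then with probability $1$ the following hold: for every $y$ the series defining $S_y(t)$, as well as the series $\sum_{n\ne0,\,P^+(|n|)\le y}X_n/n$, converges absolutely; $S_y\to F$ uniformly on $[0,1]$ as $y\to\infty$, so that $F$ is a well-defined continuous function on $[0,1]$; and the random series is the Fourier series of $F$, that is, $$\int_0^1F(t)e(-nt)\,dt=-\frac{\eta}{\pi}\frac{X_n}{n}\quad(n\in\mathbb{Z},\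 n\neq0),\qquad \int_0^1F(t)\,dt=\lim_{y\to\infty}\frac{\eta}{\pi}\sum_{\substack{n\neq 0\\ P^+(|n|)\le y}}\frac{X_n}{n}.$$ -/

import Mathlib

open MeasureTheory ProbabilityTheory Filter Topology

noncomputable section

namespace SteinhausPaths

/-- The additive character `e(x) = exp(2πix)`. -/
def e (x : ℝ) : ℂ := Complex.exp (2 * Real.pi * Complex.I * x)

/-- The largest prime factor `P⁺(n)` of a positive integer `n`, with `P⁺(1) = 1`. -/
def largestPrimeFactor (n : ℕ) : ℕ := max 1 (n.primeFactors.sup id)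

/-- The uniform distribution on the unit circle `{|z| = 1}`, as a measure on `ℂ`. -/
def uniformUnitCircle : Measure ℂ := (volume.restrict (Set.Ioc (0 : ℝ) 1)).map e

/-- The distribution of a random sign: `1` and `-1` with probability `1/2` each. -/
def randomSign : Measure ℂ :=
  (2⁻¹ : ENNReal) • Measure.dirac (1 : ℂ) + (2⁻¹ : ENNReal) • Measure.dirac (-1 : ℂ)

/-- The completely multiplicative function `n ↦ X_n` on the nonzero integers with prescribed values
`Xp p = X_p` at the primes and `Xneg = X_{-1}` at `-1`:
`X_n = ∏_{p^a ∥ n} X_p ^ a` for `n ≥ 1`, and `X_{-n} = X_{-1} X_n`.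
(Only the values of `Xp` at primes, and only `n ≠ 0`, matter.) -/
def multFun {Ω : Type*} (Xp : ℕ → Ω → ℂ) (Xneg : Ω → ℂ) (n : ℤ) (ω : Ω) : ℂ :=
  (if n < 0 then Xneg ω else 1) * n.natAbs.factorization.prod fun p a => Xp p ω ^ a

/-- `n ↦ multFun Xp Xneg n` is a Steinhaus random multiplicative function: the values at the primes
are independent and uniformly distributed on the unit circle, and the value at `-1` is a random
sign. (How `X_{-1}` depends on the `X_p` is left unrestricted.) -/
structure IsSteinhaus {Ω : Type*} [MeasurableSpace Ω] (P : Measure Ω)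
    (Xp : ℕ → Ω → ℂ) (Xneg : Ω → ℂ) : Prop where
  hasLaw_prime : ∀ p : ℕ, p.Prime → HasLaw (Xp p) uniformUnitCircle P
  indep_prime : iIndepFun (fun p : Nat.Primes => Xp (p : ℕ)) P
  hasLaw_neg_one : HasLaw Xneg randomSign P

/-- The nonzero integers `n` with `P⁺(|n|) ≤ y`. -/
def smoothInts (y : ℝ) : Set ℤ := {n | n ≠ 0 ∧ (largestPrimeFactor n.natAbs : ℝ) ≤ y}

/-- The `y`-smooth partial sum `(η/π) ∑_{n ≠ 0, P⁺(|n|) ≤ y} (1 - e(nt)) x_n / n`. -/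
def smoothSum (η : ℂ) (x : ℤ → ℂ) (y t : ℝ) : ℂ :=
  η / Real.pi * ∑' n : smoothInts y, (1 - e ((n : ℤ) * t)) / ((n : ℤ) : ℂ) * x n

/-- `F(t)`, the limit of the `y`-smooth partial sums as `y → ∞`. -/
def limitF (η : ℂ) (x : ℤ → ℂ) (t : ℝ) : ℂ :=
  limUnder atTop fun y : ℝ => smoothSum η x y t

end SteinhausPaths

end

/-!
The smooth sums converge because the random series `∑ X_n e(nt) / n` has dyadic blocks that are
almost surely exponentially small, uniformly in `t` and in the smoothness level.

By `smoothSum_eq_smoothSeries` it is enough to treat `A_y(t) = ∑_{n ≥ 1, P⁺(n) ≤ y} X_n e(nt) / n`,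
in which only the independent variables `X_p` occur; the sign `X_{-1}` and the rotation `η` enter as
constants for each outcome, so their dependence on the `X_p` is irrelevant. Split `A_y(t)` into
blocks `2 ^ j ≤ n < 2 ^ (j + 1)`. The variables `X_n` are completely multiplicative in `n` and
orthonormal (`integral_multFunNat_mul_conj`), so the twelfth moment of a block is governed by the
number of solutions of `n₁ ⋯ n₆ = m₁ ⋯ m₆` in the block (`integral_norm_sum_pow_le`), and the
divisor bound keeps that number below `O(2 ^ j)` times the number `2 ^ (6 j)` of choices of the
`nᵢ` (`exists_card_prod_eq_prod_le`). The resulting moment bound `O(32 ^ (-j))` leaves room for a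
union bound over a grid of `4 ^ j` points `t` and over the `O(2 ^ j)` values of `y` that affect the
block. A Lipschitz estimate passes from the grid to all `t`, and almost surely the blocks are
bounded by a summable sequence independent of `y` and `t`
(`ae_exists_summable_norm_dyadicBlock_le`).

The rest is deterministic. For fixed `j` the block is independent of `y` once `y ≥ 2 ^ (j + 1)`, so
dominated convergence for series gives uniform convergence of `A_y`
(`tendstoUniformly_smoothSeries`). Each smooth sum is an absolutely convergent trigonometric series,
whence its continuity and its Fourier coefficients (`fourierCoeffOn_smoothSum`), and both pass to
the uniform limit.
-/

/-! ### A divisor bound -/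

/-- The divisor bound `d(n) ≪ n ^ (1 / K)`. In the product over `p ^ a ∥ n`, a factor
`(a + 1) ^ K / p ^ a` is at most `1` when `p ≥ 2 ^ K`, and is bounded for each of the fewer than
`2 ^ K` remaining primes. -/
theorem Nat.exists_card_divisors_pow_le_mul (K : ℕ) :
    ∃ C : ℕ, 0 < C ∧ ∀ n : ℕ, n ≠ 0 → n.divisors.card ^ K ≤ C * n := by
  obtain ⟨c, hc1, hc⟩ : ∃ c : ℕ, 1 ≤ c ∧ ∀ a : ℕ, (a + 1) ^ K ≤ c * 2 ^ a := by
    have h := (tendsto_pow_const_div_const_pow_of_one_lt K (r := (2 : ℝ)) one_lt_two)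
    obtain ⟨b, hb⟩ := h.bddAbove_range
    obtain ⟨c, hc⟩ := exists_nat_ge (2 * b)
    refine ⟨c + 1, by omega, fun a => ?_⟩
    -- The bound `m ^ K / 2 ^ m ≤ b` at `m = a + 1` gives the constant `2 * b`.
    have h1 := hb ⟨a + 1, rfl⟩
    simp only [Nat.cast_add, Nat.cast_one] at h1
    rw [div_le_iff₀ (by positivity)] at h1
    have h2 : ((a : ℝ) + 1) ^ K ≤ (c + 1) * 2 ^ a := by
      have : (0 : ℝ) < 2 ^ a := by positivity
      rw [pow_succ] at h1
      nlinarith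
    exact_mod_cast h2
  refine ⟨c ^ (2 ^ K), by positivity, fun n hn => ?_⟩
  have hp : ∀ p ∈ n.primeFactors, (n.factorization p + 1) ^ K ≤
      (if p < 2 ^ K then c else 1) * p ^ n.factorization p := by
    intro p hp
    set a := n.factorization p
    split_ifs with h
    · exact (hc a).trans
        (Nat.mul_le_mul_left _ (Nat.pow_le_pow_left (Nat.prime_of_mem_primeFactors hp).two_le _))
    · rw [one_mul]
      calc (a + 1) ^ K ≤ (2 ^ a) ^ K := Nat.pow_le_pow_left (Nat.lt_two_pow_self) _
        _ = (2 ^ K) ^ a := by rw [← pow_mul, ← pow_mul, mul_comm]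
        _ ≤ p ^ a := Nat.pow_le_pow_left (not_lt.mp h) _
  rw [Nat.card_divisors hn, ← Finset.prod_pow]
  calc _ ≤ ∏ p ∈ n.primeFactors, (if p < 2 ^ K then c else 1) * p ^ n.factorization p :=
        Finset.prod_le_prod' hp
    _ = (∏ p ∈ n.primeFactors with p < 2 ^ K, c) * n := by
        rw [Finset.prod_mul_distrib, Finset.prod_filter]
        congr 1
        exact Nat.prod_factorization_pow_eq_self hn
    _ ≤ c ^ (2 ^ K) * n := by
        rw [Finset.prod_const]
        refine Nat.mul_le_mul_right _ (Nat.pow_le_pow_right hc1 ?_)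
        calc _ ≤ (Finset.range (2 ^ K)).card := Finset.card_le_card fun p hp => by
              simpa using (Finset.mem_filter.1 hp).2
          _ = 2 ^ K := Finset.card_range _

theorem Finset.card_piFinset_filter_prod_eq_le {k : ℕ} (S : Finset ℕ) (m : ℕ) (hm : m ≠ 0) :
    ((Fintype.piFinset fun _ : Fin k => S).filter fun q => ∏ i, q i = m).card ≤
      m.divisors.card ^ k := by
  calc _ ≤ (Fintype.piFinset fun _ : Fin k => m.divisors).card := by
        refine Finset.card_le_card fun q hq => ?_
        rw [Finset.mem_filter] at hq
        rw [Fintype.mem_piFinset]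
        intro i
        rw [Nat.mem_divisors]
        exact ⟨hq.2 ▸ Finset.dvd_prod_of_mem q (Finset.mem_univ i), hm⟩
    _ = _ := by simp

/-- The number of pairs of `k`-tuples from `S ⊆ [1, M]` with equal products exceeds the trivial
lower bound `|S| ^ k` by a factor `O_k(M)` at most: every entry of the second tuple divides the
product `m ≤ M ^ k` of the first, and `d(m) ^ k ≪ m ^ (1 / k)` by the divisor bound. -/
theorem exists_card_prod_eq_prod_le {k : ℕ} (hk : 0 < k) : ∃ C : ℕ, ∀ (S : Finset ℕ) (M : ℕ),
    (∀ n ∈ S, n ≠ 0 ∧ n ≤ M) →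
    ∑ p ∈ Fintype.piFinset (fun _ : Fin k => S),
      ((Fintype.piFinset fun _ : Fin k => S).filter fun q => ∏ i, q i = ∏ i, p i).card ≤
        S.card ^ k * (C * M) := by
  obtain ⟨C, hC, h⟩ := Nat.exists_card_divisors_pow_le_mul (k * k)
  refine ⟨C, fun S M hS => ?_⟩
  calc _ ≤ ∑ p ∈ Fintype.piFinset (fun _ : Fin k => S), C * M := Finset.sum_le_sum fun p hp => ?_
    _ = _ := by simp
  rw [Fintype.mem_piFinset] at hp
  have hm : ∏ i, p i ≠ 0 := Finset.prod_ne_zero_iff.2 fun i _ => (hS _ (hp i)).1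
  refine (Finset.card_piFinset_filter_prod_eq_le S _ hm).trans ?_
  -- Compare `k`-th powers, so that the divisor bound is used with the exponent `k * k`.
  refine (Nat.pow_le_pow_iff_left hk.ne').1 ?_
  rw [← pow_mul]
  calc _ ≤ C * ∏ i, p i := h _ hm
    _ ≤ C ^ k * M ^ k := by
        refine Nat.mul_le_mul (Nat.le_self_pow hk.ne' C) ?_
        calc _ ≤ ∏ _i : Fin k, M := Finset.prod_le_prod' fun i _ => (hS _ (hp i)).2
          _ = _ := by simp
    _ = (C * M) ^ k := (mul_pow _ _ _).symm

namespace SteinhausPaths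

/-! ### The character `e` and the uniform distribution on the circle -/

theorem e_add (x y : ℝ) : e (x + y) = e x * e y := by
  simp only [e, ← Complex.exp_add]; push_cast; ring_nf

theorem e_nat_mul (n : ℕ) (x : ℝ) : e (n * x) = e x ^ n := by
  simp only [e, ← Complex.exp_nat_mul]; push_cast; ring_nf

theorem conj_e (x : ℝ) : starRingEnd ℂ (e x) = e (-x) := by
  simp [e, ← Complex.exp_conj, Complex.conj_ofNat]

theorem norm_e (x : ℝ) : ‖e x‖ = 1 := by
  rw [e, show (2 * Real.pi * Complex.I * x : ℂ) = ((2 * Real.pi * x : ℝ) : ℂ) * Complex.I by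
    push_cast; ring, Complex.norm_exp_ofReal_mul_I]

theorem continuous_e : Continuous e := by unfold e; fun_prop

theorem e_int (n : ℤ) : e n = 1 := by
  rw [e, Complex.exp_eq_one_iff]
  exact ⟨n, by push_cast; ring⟩

theorem e_zero : e 0 = 1 := by simp [e]

theorem fourier_eq_e (n : ℤ) (t : ℝ) : fourier n (t : AddCircle ((1 : ℝ) - 0)) = e (n * t) := by
  rw [fourier_coe_apply, e]
  push_cast
  ring_nf

theorem integral_e_int_mul (k : ℤ) (hk : k ≠ 0) : ∫ t in (0 : ℝ)..1, e (k * t) = 0 := by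
  have hc : (2 * Real.pi * Complex.I * k : ℂ) ≠ 0 := by
    simp [Real.pi_ne_zero, hk]
  have h1 : ∀ t : ℝ, e (k * t) = Complex.exp (2 * Real.pi * Complex.I * k * t) := by
    intro t; rw [e]; push_cast; ring_nf
  simp_rw [h1]
  rw [integral_exp_mul_complex hc]
  have := e_int k
  rw [e] at this
  simp only [Complex.ofReal_intCast] at this
  simp [this]

theorem ae_norm_uniformUnitCircle : ∀ᵐ z ∂uniformUnitCircle, ‖z‖ = 1 := by
  rw [uniformUnitCircle, ae_map_iff continuous_e.measurable.aemeasurable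
    (measurableSet_eq_fun measurable_norm measurable_const)]
  exact ae_of_all _ norm_e

theorem integral_pow_mul_conj_pow (a b : ℕ) :
    ∫ z, z ^ a * (starRingEnd ℂ z) ^ b ∂uniformUnitCircle = if a = b then 1 else 0 := by
  rw [uniformUnitCircle, integral_map continuous_e.measurable.aemeasurable
    (Continuous.aestronglyMeasurable (by fun_prop)), ← intervalIntegral.integral_of_le zero_le_one]
  have : ∀ x : ℝ, e x ^ a * starRingEnd ℂ (e x) ^ b = e (((a : ℤ) - b : ℤ) * x) := by
    intro x
    rw [conj_e, ← e_nat_mul, ← e_nat_mul, ← e_add]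
    push_cast; ring_nf
  simp_rw [this]
  split_ifs with h
  · simp [h, e_zero]
  · exact integral_e_int_mul _ (by omega)

theorem ae_norm_randomSign : ∀ᵐ z ∂randomSign, ‖z‖ = 1 := by
  rw [randomSign, ae_add_measure_iff]
  constructor <;> refine Measure.ae_smul_measure ?_ _ <;>
  · rw [ae_dirac_iff (measurableSet_eq_fun measurable_norm measurable_const)]; simp

/-! ### Orthogonality of the random multiplicative function -/

/-- The restriction `n ↦ X_n = ∏_{p^a ∥ n} X_p ^ a` of `multFun` to the natural numbers, which does
not involve `X_{-1}`. Its value at `0` is the empty product `1`. -/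
def multFunNat {Ω : Type*} (Xp : ℕ → Ω → ℂ) (n : ℕ) (ω : Ω) : ℂ :=
  n.factorization.prod fun p a => Xp p ω ^ a

section

variable {Ω : Type*} {Xp : ℕ → Ω → ℂ} {Xneg : Ω → ℂ}

theorem multFun_natCast (n : ℕ) (ω : Ω) : multFun Xp Xneg n ω = multFunNat Xp n ω := by
  simp [multFun, multFunNat]

theorem multFun_neg_natCast {n : ℕ} (hn : n ≠ 0) (ω : Ω) :
    multFun Xp Xneg (-n) ω = Xneg ω * multFunNat Xp n ω := by
  simp [multFun, multFunNat, Nat.pos_of_ne_zero hn]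

theorem multFunNat_mul {m n : ℕ} (hm : m ≠ 0) (hn : n ≠ 0) (ω : Ω) :
    multFunNat Xp (m * n) ω = multFunNat Xp m ω * multFunNat Xp n ω := by
  rw [multFunNat, Nat.factorization_mul hm hn,
    Finsupp.prod_add_index' (by simp) (fun _ _ _ => pow_add _ _ _)]
  rfl

theorem multFunNat_prod {ι : Type*} (s : Finset ι) (f : ι → ℕ) (hf : ∀ i ∈ s, f i ≠ 0) (ω : Ω) :
    multFunNat Xp (∏ i ∈ s, f i) ω = ∏ i ∈ s, multFunNat Xp (f i) ω := by
  classical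
  induction s using Finset.induction_on with
  | empty => simp [multFunNat]
  | insert a s ha ih =>
    rw [Finset.prod_insert ha, Finset.prod_insert ha, multFunNat_mul (hf a (by simp))
      (Finset.prod_ne_zero_iff.2 fun i hi => hf i (by simp [hi])),
      ih fun i hi => hf i (by simp [hi])]

theorem norm_multFunNat {ω : Ω} (h : ∀ p : ℕ, p.Prime → ‖Xp p ω‖ = 1) (n : ℕ) :
    ‖multFunNat Xp n ω‖ = 1 := by
  rw [multFunNat, Finsupp.prod, norm_prod]
  refine Finset.prod_eq_one fun p hp => ?_
  rw [norm_pow, h p (Nat.prime_of_mem_primeFactors hp), one_pow]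

variable [MeasurableSpace Ω] {P : Measure Ω}

theorem aemeasurable_multFunNat (hX : IsSteinhaus P Xp Xneg) (n : ℕ) :
    AEMeasurable (multFunNat Xp n) P := by
  unfold multFunNat Finsupp.prod
  refine Finset.aemeasurable_fun_prod _ fun p hp => ?_
  exact (hX.hasLaw_prime p (Nat.prime_of_mem_primeFactors hp)).aemeasurable.pow_const _

theorem ae_norm_prime (hX : IsSteinhaus P Xp Xneg) : ∀ᵐ ω ∂P, ∀ p : ℕ, p.Prime → ‖Xp p ω‖ = 1 := by
  rw [ae_all_iff]
  intro p
  by_cases hp : p.Prime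
  · have := ae_norm_uniformUnitCircle
    rw [← (hX.hasLaw_prime p hp).map_eq] at this
    filter_upwards [ae_of_ae_map (hX.hasLaw_prime p hp).aemeasurable this] with ω h _ using h
  · exact ae_of_all _ fun ω h => absurd h hp

/-- The random variables `X_n`, `n ≥ 1`, are orthonormal: the expectation factors over the primes
by independence, and unique factorization provides a vanishing factor when `m ≠ n`. -/
theorem integral_multFunNat_mul_conj (hX : IsSteinhaus P Xp Xneg) {m n : ℕ}
    (hm : m ≠ 0) (hn : n ≠ 0) :
    ∫ ω, multFunNat Xp m ω * starRingEnd ℂ (multFunNat Xp n ω) ∂P = if m = n then 1 else 0 := by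
  classical
  set T := m.primeFactors ∪ n.primeFactors with hT
  have hTp : ∀ p ∈ T, p.Prime := by
    intro p hp
    rcases Finset.mem_union.1 hp with h | h <;> exact Nat.prime_of_mem_primeFactors h
  have hsub : ∀ (a : ℕ), a.primeFactors ⊆ T → ∀ ω, multFunNat Xp a ω =
      ∏ p : T, Xp p ω ^ a.factorization p := by
    intro a ha ω
    rw [multFunNat, Finsupp.prod_of_support_subset _ ha _ (by simp),
      ← Finset.prod_coe_sort]
  let g : T → Nat.Primes := fun p => ⟨p, hTp p p.2⟩
  have hg : Function.Injective g := fun p q h =>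
    Subtype.ext (congrArg (fun q : Nat.Primes => (q : ℕ)) h)
  have hind := hX.indep_prime.precomp hg
  have hlaw : ∀ p : T, HasLaw (Xp p) uniformUnitCircle P := fun p => hX.hasLaw_prime p (hTp p p.2)
  have key := hind.integral_fun_prod_comp (fun p : T => (hlaw p).aemeasurable)
    (f := fun (p : T) z => z ^ m.factorization p * (starRingEnd ℂ z) ^ n.factorization p)
    (fun p => Continuous.aestronglyMeasurable (by fun_prop))
  have h1 : ∀ ω, multFunNat Xp m ω * starRingEnd ℂ (multFunNat Xp n ω) =
      ∏ p : T, (Xp p ω ^ m.factorization p * (starRingEnd ℂ (Xp p ω)) ^ n.factorization p) := by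
    intro ω
    rw [hsub m Finset.subset_union_left, hsub n Finset.subset_union_right, map_prod,
      ← Finset.prod_mul_distrib]
    simp
  simp_rw [h1]
  refine key.trans ?_
  have h2 : ∀ p : T, ∫ ω, Xp p ω ^ m.factorization p *
      (starRingEnd ℂ (Xp p ω)) ^ n.factorization p ∂P =
      if m.factorization p = n.factorization p then 1 else 0 := by
    intro p
    rw [← integral_pow_mul_conj_pow]
    exact (hlaw p).integral_comp
      (f := fun z => z ^ m.factorization p * (starRingEnd ℂ z) ^ n.factorization p)
      (Continuous.aestronglyMeasurable (by fun_prop))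
  calc _ = ∏ p : T, (if m.factorization p = n.factorization p then (1 : ℂ) else 0) :=
        Finset.prod_congr rfl fun p _ => h2 p
    _ = _ := ?_
  split_ifs with hmn
  · simp [hmn]
  · obtain ⟨p, hp⟩ : ∃ p, m.factorization p ≠ n.factorization p := by
      by_contra! h
      exact hmn (Nat.eq_of_factorization_eq hm hn h)
    have hpT : p ∈ T := by
      by_contra h
      rw [hT, Finset.mem_union, not_or, ← Nat.support_factorization, ← Nat.support_factorization,
        Finsupp.notMem_support_iff, Finsupp.notMem_support_iff] at h
      exact hp (h.1.trans h.2.symm)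
    exact Finset.prod_eq_zero (Finset.mem_univ ⟨p, hpT⟩) (if_neg hp)

end

/-! ### Even moments of random sums -/

section

variable {Ω : Type*} {Xp : ℕ → Ω → ℂ} {Xneg : Ω → ℂ} [MeasurableSpace Ω] {P : Measure Ω}

theorem integrable_norm_sum_pow [IsProbabilityMeasure P] (hX : IsSteinhaus P Xp Xneg)
    (S : Finset ℕ) (c : ℕ → ℂ) (k : ℕ) :
    Integrable (fun ω => ‖∑ n ∈ S, c n * multFunNat Xp n ω‖ ^ k) P := by
  refine Integrable.of_bound (C := (∑ n ∈ S, ‖c n‖) ^ k) ?_ ?_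
  · have : AEMeasurable (fun ω => ∑ n ∈ S, c n * multFunNat Xp n ω) P :=
      Finset.aemeasurable_fun_sum _ fun n _ => (aemeasurable_multFunNat hX n).const_mul _
    exact (this.norm.pow_const k).aestronglyMeasurable
  · filter_upwards [ae_norm_prime hX] with ω h
    rw [norm_pow, norm_norm]
    refine pow_le_pow_left₀ (norm_nonneg _) ((norm_sum_le _ _).trans_eq ?_) k
    exact Finset.sum_congr rfl fun n _ => by rw [norm_mul, norm_multFunNat h, mul_one]

/-- An even moment of a random sum is bounded by a count of coincidences of products: expand the
`k`-th power of the sum by multiplicativity and use orthogonality. -/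
theorem integral_norm_sum_pow_le [IsProbabilityMeasure P] (hX : IsSteinhaus P Xp Xneg)
    {S : Finset ℕ} (hS : ∀ n ∈ S, n ≠ 0) {c : ℕ → ℂ} {B : ℝ} (hc : ∀ n ∈ S, ‖c n‖ ≤ B) (k : ℕ) :
    ∫ ω, ‖∑ n ∈ S, c n * multFunNat Xp n ω‖ ^ (2 * k) ∂P ≤ B ^ (2 * k) *
      ∑ p ∈ Fintype.piFinset (fun _ : Fin k => S),
        (((Fintype.piFinset fun _ : Fin k => S).filter fun q => ∏ i, q i = ∏ i, p i).card : ℝ) := by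
  set T := Fintype.piFinset fun _ : Fin k => S
  have hpT : ∀ p ∈ T, ∀ i, p i ∈ S := fun p hp => Fintype.mem_piFinset.1 hp
  have hp0 : ∀ p ∈ T, ∏ i, p i ≠ 0 := fun p hp =>
    Finset.prod_ne_zero_iff.2 fun i _ => hS _ (hpT p hp i)
  have hpow : ∀ ω, (∑ n ∈ S, c n * multFunNat Xp n ω) ^ k =
      ∑ p ∈ T, (∏ i, c (p i)) * multFunNat Xp (∏ i, p i) ω := by
    intro ω
    rw [Finset.sum_pow']
    refine Finset.sum_congr rfl fun p hp => ?_
    rw [Finset.prod_mul_distrib, multFunNat_prod _ _ fun i _ => hS _ (hpT p hp i)]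
  have hexp : ∀ ω, ((‖∑ n ∈ S, c n * multFunNat Xp n ω‖ ^ (2 * k) : ℝ) : ℂ) =
      ∑ p ∈ T, ∑ q ∈ T, ((∏ i, c (p i)) * starRingEnd ℂ (∏ i, c (q i))) *
        (multFunNat Xp (∏ i, p i) ω * starRingEnd ℂ (multFunNat Xp (∏ i, q i) ω)) := by
    intro ω
    rw [mul_comm, pow_mul, ← norm_pow, Complex.ofReal_pow, ← Complex.mul_conj', hpow, map_sum,
      Finset.sum_mul_sum]
    refine Finset.sum_congr rfl fun p _ => Finset.sum_congr rfl fun q _ => ?_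
    rw [map_mul]; ring
  have hint : ∀ m n : ℕ, Integrable
      (fun ω => multFunNat Xp m ω * starRingEnd ℂ (multFunNat Xp n ω)) P := by
    intro m n
    refine Integrable.of_bound (C := 1) ?_ ?_
    · exact ((aemeasurable_multFunNat hX m).mul
        (Complex.continuous_conj.measurable.comp_aemeasurable
          (aemeasurable_multFunNat hX n))).aestronglyMeasurable
    · filter_upwards [ae_norm_prime hX] with ω h
      simp [norm_multFunNat h]
  have hval : ((∫ ω, ‖∑ n ∈ S, c n * multFunNat Xp n ω‖ ^ (2 * k) ∂P : ℝ) : ℂ) =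
      ∑ p ∈ T, ∑ q ∈ T, ((∏ i, c (p i)) * starRingEnd ℂ (∏ i, c (q i))) *
        if ∏ i, p i = ∏ i, q i then 1 else 0 := by
    rw [← integral_complex_ofReal]
    simp_rw [hexp]
    rw [integral_finsetSum _ fun p _ => integrable_finsetSum _ fun q _ => (hint _ _).const_mul _]
    refine Finset.sum_congr rfl fun p hp => ?_
    rw [integral_finsetSum _ fun q _ => (hint _ _).const_mul _]
    refine Finset.sum_congr rfl fun q hq => ?_
    rw [integral_const_mul, integral_multFunNat_mul_conj hX (hp0 p hp) (hp0 q hq)]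
  have hB : ∀ p ∈ T, ‖∏ i, c (p i)‖ ≤ B ^ k := by
    intro p hp
    rw [norm_prod]
    calc _ ≤ ∏ _i : Fin k, B :=
          Finset.prod_le_prod (fun _ _ => norm_nonneg _) fun i _ => hc _ (hpT p hp i)
      _ = B ^ k := by simp
  calc _ ≤ ‖((∫ ω, ‖∑ n ∈ S, c n * multFunNat Xp n ω‖ ^ (2 * k) ∂P : ℝ) : ℂ)‖ := by
        rw [Complex.norm_real]; exact Real.le_norm_self _
    _ ≤ ∑ p ∈ T, ∑ q ∈ T, B ^ (2 * k) * if ∏ i, q i = ∏ i, p i then 1 else 0 := by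
        rw [hval]
        refine (norm_sum_le _ _).trans (Finset.sum_le_sum fun p hp => ?_)
        refine (norm_sum_le _ _).trans (Finset.sum_le_sum fun q hq => ?_)
        rw [norm_mul, norm_mul, RCLike.norm_conj, two_mul, pow_add]
        refine mul_le_mul ?_ (by simp only [eq_comm (a := ∏ i, q i)]; split_ifs <;> simp)
          (norm_nonneg _) (mul_self_nonneg _)
        exact mul_le_mul (hB p hp) (hB q hq) (norm_nonneg _) ((norm_nonneg _).trans (hB p hp))
    _ = _ := by
        rw [Finset.mul_sum]
        refine Finset.sum_congr rfl fun p _ => ?_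
        rw [← Finset.mul_sum, Finset.sum_boole]

/-- Nonnegative functions whose integrals are summable are almost surely bounded along the
sequence, since their sum has finite integral. -/
theorem ae_exists_forall_le_of_summable_integral {f : ℕ → Ω → ℝ} {a : ℕ → ℝ}
    (hf : ∀ j, Integrable (f j) P) (hf0 : ∀ j ω, 0 ≤ f j ω) (hfa : ∀ j, ∫ ω, f j ω ∂P ≤ a j)
    (ha : Summable a) : ∀ᵐ ω ∂P, ∃ C : ℝ, ∀ j, f j ω ≤ C := by
  have h0 : ∀ j, 0 ≤ a j := fun j => (integral_nonneg (hf0 j)).trans (hfa j)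
  have hmeas : ∀ j, AEMeasurable (fun ω => ENNReal.ofReal (f j ω)) P := fun j =>
    (hf j).aemeasurable.ennreal_ofReal
  have hfin : ∫⁻ ω, ∑' j, ENNReal.ofReal (f j ω) ∂P ≠ ⊤ := by
    rw [lintegral_tsum hmeas]
    refine ne_top_of_le_ne_top ha.tsum_ofReal_ne_top (ENNReal.tsum_le_tsum fun j => ?_)
    rw [← ofReal_integral_eq_lintegral_ofReal (hf j) (ae_of_all _ (hf0 j))]
    exact ENNReal.ofReal_le_ofReal (hfa j)
  filter_upwards [ae_lt_top' (AEMeasurable.tsum hmeas) hfin] with ω hω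
  refine ⟨(∑' j, ENNReal.ofReal (f j ω)).toReal, fun j => ?_⟩
  rw [← ENNReal.ofReal_le_iff_le_toReal hω.ne]
  exact ENNReal.le_tsum j

end

/-! ### Dyadic blocks -/

/-- The part `2 ^ j ≤ n < 2 ^ (j + 1)` of the series `∑_{n ≥ 1, P⁺(n) ≤ y} a_n e(nt) / n`. -/
noncomputable def dyadicBlock (a : ℕ → ℂ) (j : ℕ) (y t : ℝ) : ℂ :=
  ∑ n ∈ Finset.Ico (2 ^ j) (2 ^ (j + 1)) with (largestPrimeFactor n : ℝ) ≤ y,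
    a n / n * e (n * t)

theorem one_le_largestPrimeFactor (n : ℕ) : 1 ≤ largestPrimeFactor n := le_max_left _ _

theorem largestPrimeFactor_le {n : ℕ} (hn : n ≠ 0) : largestPrimeFactor n ≤ n :=
  max_le (Nat.one_le_iff_ne_zero.2 hn) (Finset.sup_le fun _ hp => Nat.le_of_mem_primeFactors hp)

theorem dyadicBlock_eq_of_le (a : ℕ → ℂ) {j : ℕ} {y z : ℝ} (hy : 2 ^ (j + 1) ≤ y)
    (hz : 2 ^ (j + 1) ≤ z) (t : ℝ) : dyadicBlock a j y t = dyadicBlock a j z t := by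
  unfold dyadicBlock
  congr 1
  refine Finset.filter_congr fun n hn => ?_
  rw [Finset.mem_Ico] at hn
  have h0 : n ≠ 0 := (lt_of_lt_of_le (by positivity) hn.1).ne'
  have : (largestPrimeFactor n : ℝ) ≤ 2 ^ (j + 1) := by
    exact_mod_cast (largestPrimeFactor_le h0).trans hn.2.le
  exact ⟨fun _ => this.trans hz, fun _ => this.trans hy⟩

/-- Only finitely many smoothness levels `y` matter for a given dyadic block. -/
theorem exists_nat_dyadicBlock_eq (a : ℕ → ℂ) (j : ℕ) (y t : ℝ) :
    ∃ Y : ℕ, Y < 2 ^ (j + 1) + 1 ∧ dyadicBlock a j y t = dyadicBlock a j Y t := by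
  rcases le_total (2 ^ (j + 1)) y with h | h
  · exact ⟨2 ^ (j + 1), by omega, dyadicBlock_eq_of_le a h (by push_cast; exact le_rfl) t⟩
  · refine ⟨⌊y⌋₊, Nat.lt_succ_of_le (Nat.floor_le_of_le (by push_cast; exact h)), ?_⟩
    unfold dyadicBlock
    congr 1
    refine Finset.filter_congr fun n _ => ?_
    rw [Nat.cast_le, Nat.le_floor_iff' (Nat.one_le_iff_ne_zero.1 (one_le_largestPrimeFactor n))]

theorem norm_e_sub_e_le (x y : ℝ) : ‖e x - e y‖ ≤ 2 * Real.pi * |x - y| := by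
  have h : e x - e y = e y * (e (x - y) - 1) := by
    rw [mul_sub, ← e_add, add_sub_cancel, mul_one]
  rw [h, norm_mul, norm_e, one_mul, e]
  have := Real.norm_exp_I_mul_ofReal_sub_one_le (x := 2 * Real.pi * (x - y))
  rw [Real.norm_eq_abs, abs_mul, abs_of_pos Real.two_pi_pos] at this
  convert this using 4
  push_cast; ring

theorem norm_dyadicBlock_sub_le {a : ℕ → ℂ} (ha : ∀ n, ‖a n‖ ≤ 1) (j : ℕ) (y s t : ℝ) :
    ‖dyadicBlock a j y s - dyadicBlock a j y t‖ ≤ 2 * Real.pi * 2 ^ j * |s - t| := by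
  unfold dyadicBlock
  rw [← Finset.sum_sub_distrib]
  have hterm : ∀ n ∈ Finset.Ico (2 ^ j) (2 ^ (j + 1)),
      ‖a n / n * e (n * s) - a n / n * e (n * t)‖ ≤ 2 * Real.pi * |s - t| := by
    intro n hn
    have h0 : (0 : ℝ) < n := by
      exact_mod_cast lt_of_lt_of_le (by positivity) (Finset.mem_Ico.1 hn).1
    rw [← mul_sub, norm_mul, norm_div, Complex.norm_natCast]
    calc _ ≤ 1 / n * (2 * Real.pi * |n * s - n * t|) := by
          gcongr
          · exact ha n
          · exact norm_e_sub_e_le _ _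
      _ = _ := by
          rw [← mul_sub, abs_mul, abs_of_pos h0]
          field_simp
  calc _ ≤ ∑ n ∈ Finset.Ico (2 ^ j) (2 ^ (j + 1)) with (largestPrimeFactor n : ℝ) ≤ y,
        ‖a n / n * e (n * s) - a n / n * e (n * t)‖ := norm_sum_le _ _
    _ ≤ ∑ n ∈ Finset.Ico (2 ^ j) (2 ^ (j + 1)), ‖a n / n * e (n * s) - a n / n * e (n * t)‖ :=
        Finset.sum_le_sum_of_subset_of_nonneg (Finset.filter_subset _ _)
          fun _ _ _ => norm_nonneg _
    _ ≤ _ := Finset.sum_le_sum hterm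
    _ = _ := by
        rw [Finset.sum_const, Nat.card_Ico, pow_succ, mul_two, Nat.add_sub_cancel, nsmul_eq_mul]
        push_cast; ring

theorem dyadicBlock_fract (a : ℕ → ℂ) (j : ℕ) (y t : ℝ) :
    dyadicBlock a j y (Int.fract t) = dyadicBlock a j y t := by
  unfold dyadicBlock
  refine Finset.sum_congr rfl fun n _ => ?_
  have : (n * t : ℝ) = n * Int.fract t + ((n * ⌊t⌋ : ℤ) : ℝ) := by
    rw [Int.fract]; push_cast; ring
  rw [this, e_add, e_int, mul_one]

theorem exists_nat_abs_fract_sub_le (t : ℝ) {N : ℕ} (hN : 0 < N) :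
    ∃ i < N, |Int.fract t - i / N| ≤ 1 / N := by
  have hN' : (0 : ℝ) < N := by exact_mod_cast hN
  have h0 := Int.fract_nonneg t
  refine ⟨⌊Int.fract t * N⌋₊, ?_, ?_⟩
  · rw [Nat.floor_lt (by positivity)]
    nlinarith [Int.fract_lt_one t]
  · have h1 := Nat.floor_le (show 0 ≤ Int.fract t * N by positivity)
    have h2 := Nat.lt_floor_add_one (Int.fract t * N)
    have : Int.fract t - ⌊Int.fract t * N⌋₊ / N =
        (Int.fract t * N - ⌊Int.fract t * N⌋₊) / N := by field_simp
    rw [this, abs_of_nonneg (div_nonneg (by linarith) hN'.le)]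
    gcongr
    linarith

/-! ### Almost sure uniform bounds for the dyadic blocks -/

section

variable {Ω : Type*} {Xp : ℕ → Ω → ℂ} {Xneg : Ω → ℂ} [MeasurableSpace Ω] {P : Measure Ω}

omit [MeasurableSpace Ω] in
theorem dyadicBlock_multFunNat (j : ℕ) (y t : ℝ) (ω : Ω) :
    dyadicBlock (fun n => multFunNat Xp n ω) j y t =
      ∑ n ∈ Finset.Ico (2 ^ j) (2 ^ (j + 1)) with (largestPrimeFactor n : ℝ) ≤ y,
        e (n * t) / n * multFunNat Xp n ω :=
  Finset.sum_congr rfl fun n _ => by ring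

/-- The twelfth moment of the `j`-th block is `O(32 ^ (-j))`, uniformly in `y` and `t`: the
coefficients contribute `2 ^ (-12 j)` and the count of coincidences `2 ^ (6 j) * 2 ^ (j + 1)`. -/
theorem exists_integral_norm_dyadicBlock_pow_le [IsProbabilityMeasure P]
    (hX : IsSteinhaus P Xp Xneg) : ∃ C : ℝ, 0 ≤ C ∧ ∀ (j : ℕ) (y t : ℝ),
      ∫ ω, ‖dyadicBlock (fun n => multFunNat Xp n ω) j y t‖ ^ 12 ∂P ≤ C * (1 / 32) ^ j := by
  obtain ⟨C, hC⟩ := exists_card_prod_eq_prod_le (k := 6) (by norm_num)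
  refine ⟨2 * C, by positivity, fun j y t => ?_⟩
  simp_rw [dyadicBlock_multFunNat]
  set S := (Finset.Ico (2 ^ j) (2 ^ (j + 1))).filter fun n => (largestPrimeFactor n : ℝ) ≤ y
  have hS' : ∀ n ∈ S, 2 ^ j ≤ n ∧ n < 2 ^ (j + 1) := fun n hn =>
    Finset.mem_Ico.1 (Finset.mem_filter.1 hn).1
  have hS0 : ∀ n ∈ S, n ≠ 0 := fun n hn => (lt_of_lt_of_le (by positivity) (hS' n hn).1).ne'
  have hcard : S.card ≤ 2 ^ j := by
    refine (Finset.card_filter_le _ _).trans_eq ?_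
    rw [Nat.card_Ico, pow_succ, mul_two, Nat.add_sub_cancel]
  have h1 := integral_norm_sum_pow_le hX hS0 (c := fun n => e (n * t) / n) (B := 1 / 2 ^ j)
    (fun n hn => by
      rw [norm_div, norm_e, Complex.norm_natCast]
      gcongr
      exact_mod_cast (hS' n hn).1) 6
  refine h1.trans ?_
  have h2 := hC S (2 ^ (j + 1)) fun n hn => ⟨hS0 n hn, (hS' n hn).2.le⟩
  have h3 : S.card ^ 6 * (C * 2 ^ (j + 1)) ≤ (2 ^ j) ^ 6 * (C * 2 ^ (j + 1)) :=
    Nat.mul_le_mul_right _ (Nat.pow_le_pow_left hcard 6)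
  have h4 : (∑ p ∈ Fintype.piFinset (fun _ : Fin 6 => S),
      (((Fintype.piFinset fun _ : Fin 6 => S).filter fun q => ∏ i, q i = ∏ i, p i).card : ℝ)) ≤
      (2 ^ j) ^ 6 * (C * 2 ^ (j + 1)) := by exact_mod_cast h2.trans h3
  refine (mul_le_mul_of_nonneg_left h4 (by positivity)).trans_eq ?_
  have h5 : (32 : ℝ) ^ j = (2 ^ j) ^ 5 := by rw [← pow_mul, mul_comm, pow_mul]; norm_num
  have h6 : (2 : ℝ) ^ j ≠ 0 := by positivity
  rw [one_div_pow (32 : ℝ), h5, pow_succ (2 : ℝ) j, one_div_pow ((2 : ℝ) ^ j)]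
  generalize (2 : ℝ) ^ j = u at h6 ⊢
  field_simp

/-- The union bound: the `j`-th block has `O(2 ^ j)` relevant levels `Y` and `4 ^ j` grid points
`t`, so the twelfth moments, weighted by `2 ^ j`, still have a total of `O(2 ^ (-j))`. -/
theorem ae_exists_norm_dyadicBlock_grid_le [IsProbabilityMeasure P] (hX : IsSteinhaus P Xp Xneg) :
    ∀ᵐ ω ∂P, ∃ C : ℝ, ∀ j Y i : ℕ, Y < 2 ^ (j + 1) + 1 → i < 4 ^ j →
      2 ^ j * ‖dyadicBlock (fun n => multFunNat Xp n ω) j Y (i / (4 ^ j : ℕ))‖ ^ 12 ≤ C := by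
  obtain ⟨C, hC0, hC⟩ := exists_integral_norm_dyadicBlock_pow_le hX
  have hint : ∀ (j : ℕ) (y t : ℝ), Integrable
      (fun ω => ‖dyadicBlock (fun n => multFunNat Xp n ω) j y t‖ ^ 12) P := by
    intro j y t
    simp_rw [dyadicBlock_multFunNat]
    exact integrable_norm_sum_pow hX _ _ _
  have hint' : ∀ j Y : ℕ, Integrable (fun ω => ∑ i ∈ Finset.range (4 ^ j),
      ‖dyadicBlock (fun n => multFunNat Xp n ω) j Y (i / (4 ^ j : ℕ))‖ ^ 12) P :=
    fun j Y => integrable_finsetSum _ fun i _ => hint _ _ _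
  have hint'' : ∀ j : ℕ, Integrable (fun ω => ∑ Y ∈ Finset.range (2 ^ (j + 1) + 1),
      ∑ i ∈ Finset.range (4 ^ j),
      ‖dyadicBlock (fun n => multFunNat Xp n ω) j Y (i / (4 ^ j : ℕ))‖ ^ 12) P :=
    fun j => integrable_finsetSum _ fun Y _ => hint' _ _
  have hsum : Summable fun j : ℕ => 4 * C * (1 / 2 : ℝ) ^ j := summable_geometric_two.mul_left _
  have hbd := ae_exists_forall_le_of_summable_integral
    (f := fun j ω => 2 ^ j * ∑ Y ∈ Finset.range (2 ^ (j + 1) + 1), ∑ i ∈ Finset.range (4 ^ j),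
      ‖dyadicBlock (fun n => multFunNat Xp n ω) j Y (i / (4 ^ j : ℕ))‖ ^ 12)
    (fun j => (hint'' j).const_mul _) (fun j ω => by positivity) (fun j => ?_) hsum
  · filter_upwards [hbd] with ω ⟨D, hD⟩
    refine ⟨D, fun j Y i hY hi => le_trans ?_ (hD j)⟩
    refine mul_le_mul_of_nonneg_left ?_ (by positivity)
    refine le_trans ?_ (Finset.single_le_sum (f := fun Y : ℕ => ∑ i ∈ Finset.range (4 ^ j),
      ‖dyadicBlock (fun n => multFunNat Xp n ω) j Y (i / (4 ^ j : ℕ))‖ ^ 12)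
      (fun _ _ => by positivity) (Finset.mem_range.2 hY))
    exact Finset.single_le_sum (f := fun i : ℕ =>
      ‖dyadicBlock (fun n => multFunNat Xp n ω) j Y (i / (4 ^ j : ℕ))‖ ^ 12)
      (fun _ _ => by positivity) (Finset.mem_range.2 hi)
  · rw [integral_const_mul, integral_finsetSum _ fun Y _ => hint' _ _]
    simp_rw [integral_finsetSum _ fun i _ => hint _ _ _]
    calc _ ≤ (2 : ℝ) ^ j * ∑ Y ∈ Finset.range (2 ^ (j + 1) + 1), ∑ i ∈ Finset.range (4 ^ j),
          C * (1 / 32) ^ j := by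
          gcongr
          exact hC _ _ _
      _ = (2 : ℝ) ^ j * ((2 ^ (j + 1) + 1) * (4 ^ j * (C * (1 / 32) ^ j))) := by simp
      _ ≤ (2 : ℝ) ^ j * (4 * 2 ^ j * (4 ^ j * (C * (1 / 32) ^ j))) := by
          gcongr
          have : (1 : ℝ) ≤ 2 ^ j := one_le_pow₀ one_le_two
          rw [pow_succ]; linarith
      _ = 4 * C * (2 * 2 * 4 * (1 / 32)) ^ j := by
          simp only [mul_pow]; ring
      _ = _ := by norm_num

/-- Almost surely the dyadic blocks are bounded by a summable sequence, uniformly in both the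
smoothness level `y` and the point `t`. -/
theorem ae_exists_summable_norm_dyadicBlock_le [IsProbabilityMeasure P]
    (hX : IsSteinhaus P Xp Xneg) : ∀ᵐ ω ∂P, ∃ M : ℕ → ℝ, Summable M ∧ ∀ j y t,
      ‖dyadicBlock (fun n => multFunNat Xp n ω) j y t‖ ≤ M j := by
  filter_upwards [ae_exists_norm_dyadicBlock_grid_le hX, ae_norm_prime hX] with ω ⟨C, hC⟩ hω
  set D := max C 1 with hD
  have hD1 : 1 ≤ D := le_max_right _ _
  -- The ratio `19 / 20` is chosen so that `(19 / 20) ^ 12 ≥ 1 / 2`.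
  refine ⟨fun j => D * (19 / 20) ^ j + 2 * Real.pi * (1 / 2) ^ j,
    ((summable_geometric_of_lt_one (by norm_num) (by norm_num)).mul_left _).add
      (summable_geometric_two.mul_left _), fun j y t => ?_⟩
  obtain ⟨Y, hY, hYeq⟩ := exists_nat_dyadicBlock_eq (fun n => multFunNat Xp n ω) j y t
  obtain ⟨i, hi, hit⟩ := exists_nat_abs_fract_sub_le t (N := 4 ^ j) (by positivity)
  rw [hYeq, ← dyadicBlock_fract]
  have h1 := norm_dyadicBlock_sub_le (a := fun n => multFunNat Xp n ω)
    (fun n => (norm_multFunNat hω n).le) j Y (Int.fract t) (i / (4 ^ j : ℕ))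
  have h2 : 2 * Real.pi * 2 ^ j * |Int.fract t - i / (4 ^ j : ℕ)| ≤
      2 * Real.pi * (1 / 2) ^ j := by
    calc _ ≤ 2 * Real.pi * 2 ^ j * (1 / (4 ^ j : ℕ)) := by gcongr
      _ = 2 * Real.pi * (2 * (1 / 4)) ^ j := by
          push_cast; rw [mul_pow, one_div_pow]; ring
      _ = _ := by norm_num
  have h3 : ‖dyadicBlock (fun n => multFunNat Xp n ω) j Y (i / (4 ^ j : ℕ))‖ ≤
      D * (19 / 20) ^ j := by
    refine (pow_le_pow_iff_left₀ (norm_nonneg _) (by positivity) (n := 12) (by norm_num)).1 ?_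
    have h4 := (hC j Y i hY hi).trans (le_max_left C 1)
    rw [← hD, mul_comm, ← le_div_iff₀ (by positivity)] at h4
    calc _ ≤ D / 2 ^ j := h4
      _ = D * (1 / 2) ^ j := by rw [one_div_pow]; ring
      _ ≤ D ^ 12 * ((19 / 20) ^ 12) ^ j := by
          gcongr
          · exact le_self_pow₀ hD1 (by norm_num)
          · norm_num
      _ = _ := by rw [mul_pow, ← pow_mul, ← pow_mul, mul_comm 12]
  calc _ ≤ ‖dyadicBlock (fun n => multFunNat Xp n ω) j Y (i / (4 ^ j : ℕ))‖ +
        ‖dyadicBlock (fun n => multFunNat Xp n ω) j Y (Int.fract t) -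
          dyadicBlock (fun n => multFunNat Xp n ω) j Y (i / (4 ^ j : ℕ))‖ := norm_le_insert' _ _
    _ ≤ _ := add_le_add h3 (h1.trans h2)

end

/-! ### Absolute convergence over smooth integers -/

/-- The positive integers `n` with `P⁺(n) ≤ y`. -/
def smoothNats (y : ℝ) : Set ℕ := {n | n ≠ 0 ∧ (largestPrimeFactor n : ℝ) ≤ y}

theorem summable_indicator_smoothNats (y : ℝ) :
    Summable ((smoothNats y).indicator fun n : ℕ => (n : ℝ)⁻¹) := by
  obtain ⟨f, hf⟩ : ∃ f : ℕ →* ℝ, ∀ n, f n = (n : ℝ)⁻¹ :=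
    ⟨⟨⟨fun n => (n : ℝ)⁻¹, by simp⟩, fun m n => by simp [mul_comm]⟩, fun _ => rfl⟩
  have hf' : ∀ n, ‖f n‖ = (n : ℝ)⁻¹ := fun n => by rw [hf, norm_inv, Real.norm_natCast]
  have h := (EulerProduct.summable_and_hasSum_smoothNumbers_prod_primesBelow_geometric (f := f)
    (fun {p} hp => by
      have : (1 : ℝ) < p := by exact_mod_cast hp.one_lt
      rw [hf']
      exact inv_lt_one_of_one_lt₀ this) (⌊y⌋₊ + 1)).1
  simp only [hf'] at h
  have h' := (summable_subtype_iff_indicator (f := fun n : ℕ => (n : ℝ)⁻¹)).1 h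
  refine Summable.of_nonneg_of_le (fun n => Set.indicator_nonneg (fun _ _ => by positivity) _)
    (fun n => ?_) h'
  have hsub : smoothNats y ⊆ Nat.smoothNumbers (⌊y⌋₊ + 1) := by
    rintro n ⟨hn, hny⟩
    refine Nat.mem_smoothNumbers.2 ⟨hn, fun p hp => Nat.lt_succ_of_le (Nat.le_floor ?_)⟩
    refine le_trans ?_ hny
    have hp' : p ∈ n.primeFactors := Nat.mem_primeFactors_iff_mem_primeFactorsList.2 hp
    exact_mod_cast (Finset.le_sup (f := id) hp').trans (le_max_right _ _)
  exact Set.indicator_le_indicator_of_subset hsub (fun n => by positivity) n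

theorem natCast_mem_smoothInts {y : ℝ} {n : ℕ} : (n : ℤ) ∈ smoothInts y ↔ n ∈ smoothNats y := by
  simp [smoothInts, smoothNats]

theorem neg_natCast_mem_smoothInts {y : ℝ} {n : ℕ} :
    (-n : ℤ) ∈ smoothInts y ↔ n ∈ smoothNats y := by
  simp [smoothInts, smoothNats]

theorem zero_notMem_smoothInts (y : ℝ) : (0 : ℤ) ∉ smoothInts y := fun h => h.1 rfl

theorem summable_smoothInts (y : ℝ) : Summable fun n : smoothInts y => |((n : ℤ) : ℝ)|⁻¹ := by
  refine summable_subtype_iff_indicator (f := fun n : ℤ => |(n : ℝ)|⁻¹).2 ?_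
  refine Summable.of_nat_of_neg ?_ ?_ <;>
  · refine (summable_indicator_smoothNats y).congr fun n => ?_
    classical
    simp [Set.indicator_apply, natCast_mem_smoothInts, neg_natCast_mem_smoothInts]

theorem summable_norm_of_le_div {y : ℝ} {g : ℤ → ℂ} {K : ℝ}
    (hg : ∀ n, n ≠ 0 → ‖g n‖ ≤ K * |(n : ℝ)|⁻¹) :
    Summable fun n : smoothInts y => ‖g n‖ :=
  Summable.of_nonneg_of_le (fun _ => norm_nonneg _) (fun n => hg n n.2.1)
    ((summable_smoothInts y).mul_left K)

/-! ### Uniform convergence of the smooth sums -/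

/-- The series `∑_{n ≥ 1, P⁺(n) ≤ y} a_n e(nt) / n`. -/
noncomputable def smoothSeries (a : ℕ → ℂ) (y t : ℝ) : ℂ :=
  ∑' n, (smoothNats y).indicator (fun n => a n / n * e (n * t)) n

section

variable {a : ℕ → ℂ} (ha : ∀ n, ‖a n‖ ≤ 1)
include ha

theorem hasSum_smoothSeries (y t : ℝ) :
    HasSum ((smoothNats y).indicator fun n => a n / n * e (n * t)) (smoothSeries a y t) := by
  refine (Summable.of_norm_bounded (summable_indicator_smoothNats y) fun n => ?_).hasSum
  rw [norm_indicator_eq_indicator_norm]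
  refine Set.indicator_le_indicator ?_
  rw [norm_mul, norm_e, mul_one, norm_div, Complex.norm_natCast, div_eq_mul_inv]
  exact mul_le_of_le_one_left (by positivity) (ha n)

theorem hasSum_dyadicBlock (y t : ℝ) :
    HasSum (fun j => dyadicBlock a j y t) (smoothSeries a y t) := by
  classical
  have h := (hasSum_smoothSeries ha y t).tsum_fiberwise (Nat.log 2)
  suffices hj : ∀ j, ∑' n : Nat.log 2 ⁻¹' {j},
      (smoothNats y).indicator (fun n => a n / n * e (n * t)) n = dyadicBlock a j y t by
    simpa only [hj] using h
  intro j
  rw [tsum_subtype (Nat.log 2 ⁻¹' {j})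
    ((smoothNats y).indicator fun n => a n / n * e (n * t)),
    tsum_eq_sum (s := Finset.Ico (2 ^ j) (2 ^ (j + 1))), dyadicBlock, Finset.sum_filter]
  · refine Finset.sum_congr rfl fun n hn => ?_
    rw [Finset.mem_Ico] at hn
    have h0 : n ≠ 0 := (lt_of_lt_of_le (by positivity) hn.1).ne'
    have hlog : Nat.log 2 n = j := Nat.log_eq_of_pow_le_of_lt_pow hn.1 hn.2
    simp [Set.indicator_apply, hlog, smoothNats, h0]
  · intro n hn
    rcases eq_or_ne n 0 with rfl | h0
    · -- `Nat.log 2 0 = 0` puts `n = 0` in the fibre of `j = 0`; it is not a smooth number.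
      simp [smoothNats]
    · refine Set.indicator_of_notMem (fun hlog => hn ?_) _
      rw [Finset.mem_Ico, ← Set.mem_singleton_iff.1 hlog]
      exact ⟨Nat.pow_log_le_self 2 h0, Nat.lt_pow_succ_log_self one_lt_two n⟩

/-- For `y ≥ 2 ^ (j + 1)` the `j`-th block no longer depends on `y`. Blocks dominated by a
summable sequence therefore give uniform convergence as `y → ∞`, by Tannery's theorem. -/
theorem tendstoUniformly_smoothSeries {M : ℕ → ℝ} (hM : Summable M)
    (hb : ∀ j y t, ‖dyadicBlock a j y t‖ ≤ M j) :
    TendstoUniformly (smoothSeries a) (fun t => ∑' j, dyadicBlock a j (2 ^ (j + 1)) t) atTop := by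
  have hlim : Tendsto (fun y : ℝ => ∑' j : ℕ, if (2 : ℝ) ^ (j + 1) ≤ y then 0 else 2 * M j) atTop
      (𝓝 0) := by
    have hM0 : ∀ j, 0 ≤ M j := fun j => (norm_nonneg _).trans (hb j 0 0)
    suffices h : Tendsto (fun y : ℝ => ∑' j : ℕ, if (2 : ℝ) ^ (j + 1) ≤ y then 0 else 2 * M j)
        atTop (𝓝 (∑' _ : ℕ, (0 : ℝ))) by rwa [tsum_zero] at h
    refine tendsto_tsum_of_dominated_convergence (hM.mul_left 2) (fun j => ?_)
      (Eventually.of_forall fun y j => ?_)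
    · refine tendsto_const_nhds.congr' ?_
      filter_upwards [eventually_ge_atTop ((2 : ℝ) ^ (j + 1))] with y hy
      rw [if_pos hy]
    · have := hM0 j
      split_ifs
      · simpa using this
      · rw [Real.norm_of_nonneg (by positivity)]
  rw [Metric.tendstoUniformly_iff]
  intro ε hε
  filter_upwards [hlim.eventually_lt_const hε] with y hy t
  refine lt_of_le_of_lt ?_ hy
  have hs : Summable fun j => dyadicBlock a j (2 ^ (j + 1)) t :=
    Summable.of_norm_bounded hM fun j => hb _ _ _
  have hM0 : ∀ j, 0 ≤ M j := fun j => (norm_nonneg _).trans (hb j 0 0)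
  rw [dist_eq_norm, ← (hasSum_dyadicBlock ha y t).tsum_eq,
    ← hs.tsum_sub (hasSum_dyadicBlock ha y t).summable]
  refine tsum_of_norm_bounded (Summable.hasSum ?_) fun j => ?_
  · refine Summable.of_nonneg_of_le (fun j => ?_) (fun j => ?_) (hM.mul_left 2) <;>
      have := hM0 j <;> split_ifs <;> simp [this]
  · split_ifs with h
    · rw [dyadicBlock_eq_of_le a le_rfl h, sub_self, norm_zero]
    · rw [two_mul]
      exact (norm_sub_le _ _).trans (add_le_add (hb _ _ _) (hb _ _ _))

/-- The two-sided smooth sum in terms of the one-sided series: the negative integers contribute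
the factor `x_{-1} = s` and the point `-t`. -/
theorem smoothSum_eq_smoothSeries {x : ℤ → ℂ} {s : ℂ} (hx : ∀ n : ℕ, x n = a n)
    (hx' : ∀ n : ℕ, n ≠ 0 → x (-n) = s * a n) (η : ℂ) (y t : ℝ) :
    smoothSum η x y t = η / Real.pi * ((smoothSeries a y 0 - smoothSeries a y t) -
      s * (smoothSeries a y 0 - smoothSeries a y (-t))) := by
  classical
  rw [smoothSum]
  congr 1
  rw [tsum_subtype (smoothInts y) fun n : ℤ => (1 - e (n * t)) / (n : ℂ) * x n]
  have h := fun t => hasSum_smoothSeries ha y t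
  have key := HasSum.of_nat_of_neg
    (f := (smoothInts y).indicator fun n : ℤ => (1 - e (n * t)) / (n : ℂ) * x n)
    (g := smoothSeries a y 0 - smoothSeries a y t)
    (g' := -s * (smoothSeries a y 0 - smoothSeries a y (-t)))
    (((h 0).sub (h t)).congr_fun fun n => ?_) ((((h 0).sub (h (-t))).mul_left (-s)).congr_fun
    fun n => ?_)
  · rw [key.tsum_eq, Set.indicator_of_notMem (zero_notMem_smoothInts y)]
    ring
  · by_cases hn : n ∈ smoothNats y
    · simp [natCast_mem_smoothInts, hn, hx, e_zero]
      ring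
    · simp [natCast_mem_smoothInts, hn]
  · by_cases hn : n ∈ smoothNats y
    · simp [neg_natCast_mem_smoothInts, hn, hx' n hn.1, e_zero]
      ring
    · simp [neg_natCast_mem_smoothInts, hn]

end

/-! ### Fourier coefficients -/

theorem integral_e_int_mul_eq_ite (k : ℤ) :
    ∫ t in (0 : ℝ)..1, e (k * t) = if k = 0 then 1 else 0 := by
  split_ifs with h
  · simp [h, e_zero]
  · exact integral_e_int_mul k h

theorem integral_e_neg_mul_one_sub_e (m n : ℤ) :
    ∫ t in (0 : ℝ)..1, e ((-m : ℤ) * t) * (1 - e (n * t)) =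
      (if m = 0 then 1 else 0) - if n = m then 1 else 0 := by
  have h : ∀ t : ℝ, e ((-m : ℤ) * t) * (1 - e (n * t)) =
      e ((-m : ℤ) * t) - e ((n - m : ℤ) * t) := by
    intro t
    rw [mul_sub, mul_one, ← e_add]
    push_cast; ring_nf
  have hint : ∀ k : ℤ, IntervalIntegrable (fun t : ℝ => e (k * t)) volume 0 1 := fun k =>
    (continuous_e.comp (by fun_prop)).intervalIntegrable _ _
  simp_rw [h]
  rw [intervalIntegral.integral_sub (hint _) (hint _), integral_e_int_mul_eq_ite,
    integral_e_int_mul_eq_ite]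
  simp [sub_eq_zero]

theorem fourierCoeffOn_zero_one (f : ℝ → ℂ) (m : ℤ) :
    fourierCoeffOn (zero_lt_one : (0 : ℝ) < 1) f m = ∫ t in (0 : ℝ)..1, e ((-m : ℤ) * t) * f t := by
  rw [fourierCoeffOn_eq_integral]
  simp_rw [fourier_eq_e]
  simp

section

variable {x : ℤ → ℂ} (hx : ∀ n, ‖x n‖ ≤ 1)
include hx

theorem norm_smoothSum_term_le (t : ℝ) (n : ℤ) :
    ‖(1 - e (n * t)) / (n : ℂ) * x n‖ ≤ 2 * |(n : ℝ)|⁻¹ := by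
  rw [norm_mul, norm_div, Complex.norm_intCast, div_eq_mul_inv]
  have h : ‖1 - e (n * t)‖ ≤ 2 := by
    refine (norm_sub_le _ _).trans ?_
    rw [norm_e, norm_one]; norm_num
  calc _ ≤ 2 * |(n : ℝ)|⁻¹ * 1 := by gcongr; exact hx n
    _ = _ := mul_one _

theorem summable_norm_smoothSum_term (y t : ℝ) :
    Summable fun n : smoothInts y => ‖(1 - e ((n : ℤ) * t)) / ((n : ℤ) : ℂ) * x n‖ :=
  summable_norm_of_le_div (K := 2) (g := fun n : ℤ => (1 - e (n * t)) / (n : ℂ) * x n)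
    fun n _ => norm_smoothSum_term_le hx t n

theorem continuous_smoothSum (η : ℂ) (y : ℝ) : Continuous (smoothSum η x y) := by
  unfold smoothSum
  refine continuous_const.mul (continuous_tsum (fun n => ?_) ((summable_smoothInts y).mul_left 2)
    fun n t => norm_smoothSum_term_le hx t n)
  have : Continuous fun t : ℝ => e ((n : ℤ) * t) := continuous_e.comp (by fun_prop)
  fun_prop

theorem fourierCoeffOn_smoothSum (η : ℂ) (y : ℝ) (m : ℤ) :
    fourierCoeffOn (zero_lt_one : (0 : ℝ) < 1) (smoothSum η x y) m = η / Real.pi *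
      ∑' n : smoothInts y, ((if m = 0 then 1 else 0) - if (n : ℤ) = m then 1 else 0) *
        (x n / ((n : ℤ) : ℂ)) := by
  rw [fourierCoeffOn_zero_one]
  unfold smoothSum
  have hterm : ∀ n : smoothInts y, Continuous fun t : ℝ =>
      e ((-m : ℤ) * t) * ((1 - e ((n : ℤ) * t)) / ((n : ℤ) : ℂ) * x n) := by
    intro n
    have h : ∀ k : ℤ, Continuous fun t : ℝ => e (k * t) := fun k =>
      continuous_e.comp (by fun_prop)
    have h1 := h n
    have h2 := h (-m)
    fun_prop
  have h := intervalIntegral.hasSum_integral_of_dominated_convergence (μ := volume)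
    (a := 0) (b := 1)
    (F := fun (n : smoothInts y) (t : ℝ) =>
      e ((-m : ℤ) * t) * ((1 - e ((n : ℤ) * t)) / ((n : ℤ) : ℂ) * x n))
    (f := fun t => e ((-m : ℤ) * t) *
      ∑' n : smoothInts y, (1 - e ((n : ℤ) * t)) / ((n : ℤ) : ℂ) * x n)
    (fun n _ => 2 * |((n : ℤ) : ℝ)|⁻¹)
    (fun n => (hterm n).aestronglyMeasurable)
    (fun n => ae_of_all _ fun t _ => by
      rw [norm_mul, norm_e, one_mul]; exact norm_smoothSum_term_le hx t n)
    (ae_of_all _ fun t _ => (summable_smoothInts y).mul_left 2)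
    (by simp)
    (ae_of_all _ fun t _ => (summable_norm_smoothSum_term hx y t).of_norm.hasSum.mul_left _)
  simp_rw [mul_left_comm _ (η / (Real.pi : ℂ))]
  rw [intervalIntegral.integral_const_mul, ← h.tsum_eq]
  congr 1
  refine tsum_congr fun n => ?_
  rw [← integral_e_neg_mul_one_sub_e, ← intervalIntegral.integral_mul_const]
  refine intervalIntegral.integral_congr fun t _ => ?_
  ring

theorem fourierCoeffOn_smoothSum_of_mem (η : ℂ) {y : ℝ} {m : ℤ} (hm : m ∈ smoothInts y) :
    fourierCoeffOn (zero_lt_one : (0 : ℝ) < 1) (smoothSum η x y) m =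
      -(η / Real.pi * (x m / m)) := by
  rw [fourierCoeffOn_smoothSum hx, tsum_eq_single (⟨m, hm⟩ : smoothInts y)]
  · simp [hm.1]
  · intro n hn
    have : (n : ℤ) ≠ m := fun h => hn (Subtype.ext h)
    simp [this, hm.1]

theorem fourierCoeffOn_smoothSum_zero (η : ℂ) (y : ℝ) :
    fourierCoeffOn (zero_lt_one : (0 : ℝ) < 1) (smoothSum η x y) 0 =
      η / Real.pi * ∑' n : smoothInts y, x n / ((n : ℤ) : ℂ) := by
  rw [fourierCoeffOn_smoothSum hx]
  congr 1
  refine tsum_congr fun n => ?_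
  simp [n.2.1]

end

theorem tendsto_fourierCoeffOn {f : ℝ → ℝ → ℂ} {F : ℝ → ℂ} (hf : ∀ y, Continuous (f y))
    (h : TendstoUniformly f F atTop) (m : ℤ) :
    Tendsto (fun y => fourierCoeffOn (zero_lt_one : (0 : ℝ) < 1) (f y) m) atTop
      (𝓝 (fourierCoeffOn (zero_lt_one : (0 : ℝ) < 1) F m)) := by
  simp_rw [fourierCoeffOn_zero_one]
  refine TendstoUniformlyOn.tendsto_intervalIntegral_of_continuousOn
    (Eventually.of_forall fun y => ?_) ?_
  · exact ((continuous_e.comp (by fun_prop)).mul (hf y)).continuousOn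
  · rw [Metric.tendstoUniformlyOn_iff]
    rw [Metric.tendstoUniformly_iff] at h
    intro ε hε
    filter_upwards [h ε hε] with y hy t _
    rw [dist_eq_norm, ← mul_sub, norm_mul, norm_e, one_mul, ← dist_eq_norm]
    exact hy t

/-! ### Almost sure convergence and Fourier series -/

theorem tendstoUniformly_sub_sub {u : ℝ → ℝ → ℂ} {G : ℝ → ℂ}
    (hu : TendstoUniformly u G atTop) (c s : ℂ) : TendstoUniformly
      (fun y t => c * ((u y 0 - u y t) - s * (u y 0 - u y (-t))))
      (fun t => c * ((G 0 - G t) - s * (G 0 - G (-t)))) atTop := by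
  have h0 := hu.comp fun _ : ℝ => (0 : ℝ)
  have h1 := (h0.sub hu).sub ((uniformContinuous_const_smul s).comp_tendstoUniformly
    (h0.sub (hu.comp fun t : ℝ => -t)))
  exact (uniformContinuous_const_smul c).comp_tendstoUniformly h1

theorem ae_norm_multFun {Ω : Type*} [MeasurableSpace Ω] {P : Measure Ω} {Xp : ℕ → Ω → ℂ}
    {Xneg : Ω → ℂ} (hX : IsSteinhaus P Xp Xneg) :
    ∀ᵐ ω ∂P, ∀ n, ‖multFun Xp Xneg n ω‖ = 1 := by
  have hneg : ∀ᵐ ω ∂P, ‖Xneg ω‖ = 1 := by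
    have := ae_norm_randomSign
    rw [← hX.hasLaw_neg_one.map_eq] at this
    exact ae_of_ae_map hX.hasLaw_neg_one.aemeasurable this
  filter_upwards [hneg, ae_norm_prime hX] with ω h1 h2 n
  rw [multFun, norm_mul]
  change _ * ‖multFunNat Xp n.natAbs ω‖ = 1
  rw [norm_multFunNat h2, mul_one]
  split_ifs <;> simp [h1]

end SteinhausPaths

open SteinhausPaths

theorem mainTheorem2 {Ω : Type*} [MeasurableSpace Ω] (P : Measure Ω) [IsProbabilityMeasure P]
    (Xp : ℕ → Ω → ℂ) (Xneg : Ω → ℂ) (hX : SteinhausPaths.IsSteinhaus P Xp Xneg)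
    (η : Ω → ℂ) (hη : HasLaw η SteinhausPaths.uniformUnitCircle P) :
    ∀ᵐ ω ∂P,
      let x : ℤ → ℂ := fun n => SteinhausPaths.multFun Xp Xneg n ω
      let F : ℝ → ℂ := SteinhausPaths.limitF (η ω) x
      -- every smooth partial sum is an absolutely convergent series
      (∀ y t : ℝ, Summable fun n : SteinhausPaths.smoothInts y =>
        ‖(1 - SteinhausPaths.e ((n : ℤ) * t)) / ((n : ℤ) : ℂ) * x n‖) ∧
      -- the smooth partial sums converge uniformly to `F`, and `F` is continuous
      TendstoUniformlyOn (fun y : ℝ => SteinhausPaths.smoothSum (η ω) x y) F atTop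
        (Set.Icc 0 1) ∧
      ContinuousOn F (Set.Icc 0 1) ∧
      -- the random series is the Fourier series of `F`
      (∀ n : ℤ, n ≠ 0 →
        fourierCoeffOn (zero_lt_one : (0 : ℝ) < 1) F n = -(η ω / Real.pi * (x n / n))) ∧
      (∀ y : ℝ, Summable fun n : SteinhausPaths.smoothInts y => ‖x n / ((n : ℤ) : ℂ)‖) ∧
      Tendsto (fun y : ℝ => η ω / Real.pi *
          ∑' n : SteinhausPaths.smoothInts y, x n / ((n : ℤ) : ℂ)) atTop
        (𝓝 (fourierCoeffOn (zero_lt_one : (0 : ℝ) < 1) F 0)) := by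
  filter_upwards [ae_exists_summable_norm_dyadicBlock_le hX, ae_norm_prime hX, ae_norm_multFun hX]
    with ω ⟨M, hM, hb⟩ hp hx1
  intro x F
  have hx : ∀ n, ‖x n‖ ≤ 1 := fun n => (hx1 n).le
  obtain ⟨H, hH⟩ : ∃ H, TendstoUniformly (smoothSum (η ω) x) H atTop := by
    have ha : ∀ n, ‖multFunNat Xp n ω‖ ≤ 1 := fun n => (norm_multFunNat hp n).le
    have hS : smoothSum (η ω) x = _ := funext fun y => funext fun t =>
      smoothSum_eq_smoothSeries ha (fun n => multFun_natCast n ω)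
        (fun n hn => multFun_neg_natCast hn ω) (η ω) y t
    rw [hS]
    exact ⟨_, tendstoUniformly_sub_sub (tendstoUniformly_smoothSeries ha hM hb) _ _⟩
  have hF : F = H := funext fun t => (hH.tendsto_at t).limUnder_eq
  rw [← hF] at hH
  have hcont : ∀ y, Continuous (smoothSum (η ω) x y) := continuous_smoothSum hx (η ω)
  refine ⟨fun y t => summable_norm_smoothSum_term hx y t,
    hH.tendstoUniformlyOn,
    (hH.continuous (Frequently.of_forall hcont)).continuousOn, fun n hn => ?_, fun y => ?_, ?_⟩
  · refine tendsto_nhds_unique (tendsto_fourierCoeffOn hcont hH n) (tendsto_const_nhds.congr' ?_)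
    -- Once `n` is `y`-smooth, the `n`-th coefficient of the smooth sum no longer changes.
    filter_upwards [eventually_ge_atTop (largestPrimeFactor n.natAbs : ℝ)] with y hy
    exact (fourierCoeffOn_smoothSum_of_mem hx (η ω) ⟨hn, hy⟩).symm
  · refine summable_norm_of_le_div (K := 1) (g := fun n => x n / (n : ℂ)) fun n _ => ?_
    rw [norm_div, Complex.norm_intCast, div_eq_mul_inv]
    gcongr
    exact hx n
  · exact (tendsto_fourierCoeffOn hcont hH 0).congr fun y => fourierCoeffOn_smoothSum_zero hx _ y
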